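/- Let $d\in\mathbb N$ and $\sigma>0$. For a multi-index $n\in\mathbb N_0^d$ put $|n|=n_1+\dots+n_d$, $n!=n_1!\cdots n_d!$, $(-1)^n=(-1)^{|n|}$, $2n=(2n_1,\dots,2n_d)$, and $\binom{\gamma}{n}=\prod_{j=1}^d\frac{\gamma_j(\gamma_j-1)\cdots(\gamma_j-n_j+1)}{n_j!}$ for $\gamma\in\mathbb R^d$; let $\mathbf{3/2}=(3/2,\dots,3/2)$. Let $$h_n(x)=\prod_{j=1}^d (2^{n_j}n_j!\sqrt\pi)^{-1/2}(-1)^{n_j}e^{x_j^2/2}\frac{d^{n_j}}{dx_j^{n_j}}e^{-x_j^2}\quad(x\in\mathbb R^d),\qquad l_n(x)=\prod_{j=1}^d \frac{e^{x_j/2}}{n_j!}\frac{d^{n_j}}{dx_j^{n_j}}\big(e^{-x_j}x_j^{n_j}\big)\quad(x\in\mathbb R^d_+=(0,\infty)^d)$$ be the Hermite and Laguerre functions. For $\tau>0$ let $\ell_{\flat_\tau}(\mathbb N_0^d)$ be the set of complex sequences $\{a_n\}_{n\in\mathbb N_0^d}$ such that $\sup_n |a_n|\,h^{|n|}\,n!^{1/(2\tau)}<\infty$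 for some $h>0$. Let $\mathcal H_{\flat_\sigma,even}(\mathbb R^d)$ be the space of functions $f=\sum_n a_nh_n$ on $\mathbb R^d$ with $\{a_n\}\in\ell_{\flat_\sigma}(\mathbb N_0^d)$ that are even in each variable, and let $\mathcal G_{\flat_\sigma}(\mathbb R^d_+)$ be the space of functions $\sum_n b_nl_n$ on $\mathbb R^d_+$ with $\{b_n\}\in\ell_{\flat_{\sigma/2}}(\mathbb N_0^d)$; all series converge absolutely at every point. Let $w(x)=(\sqrt{x_1},\dots,\sqrt{x_d})$ for $x\in\mathbb R^d_+$. Let $f\in\mathcal H_{\flat_\sigma,even}(\mathbb R^d)$ have the Hermite expansion $f=\sum_n a_n h_n$ with $\{a_n\}\in\ell_{\flat_\sigma}(\mathbb N_0^d)$. Then $f=\sum_{n} a_{2n}h_{2n}$ on $\mathbb R^d$; the function $g=f|_{\mathbb R^d_+}\circ w$ belongs to $\mathcal G_{\flat_\sigma}(\mathbb R^d_+)$; its Laguerre coefficients $b_n=\int_{\mathbb R^d_+}g(x)\,l_n(x)\,dx$ exist, satisfy $\{b_n\}_{n\in\mathbb N_0^d}\in\ell_{\flat_\sigma}(\mathbb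 N_0^d)$ and $$g=f|_{\mathbb R^d_+}\circ w=\sum_{n\in\mathbb N_0^d}b_n\,l_n\quad\text{on }\mathbb R^d_+,$$ and are given by the absolutely convergent series $$b_n=\frac{(-1)^n2^{|n|}}{\pi^{d/4}}\sum_{k\in\mathbb N_0^d}\binom{k-\mathbf{3/2}}{k}\frac{(-1)^{|k|}2^{|k|}(k+n)!\,a_{2(k+n)}}{\sqrt{(2(k+n))!}},\qquad n\in\mathbb N_0^d.$$ -/

import Mathlib

open scoped Nat BigOperators

noncomputable section

namespace FlatPilipovic

/-- The length `|n| = n₁ + ⋯ + n_d` of a multi-index. -/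
def multiLength {d : ℕ} (n : Fin d → ℕ) : ℕ := ∑ i, n i

/-- The factorial `n! = n₁! ⋯ n_d!` of a multi-index. -/
def multiFactorial {d : ℕ} (n : Fin d → ℕ) : ℕ := ∏ i, (n i)!

/-- The generalized binomial coefficient `γ (γ - 1) ⋯ (γ - m + 1) / m!` of a real `γ`. -/
def binom (γ : ℝ) (m : ℕ) : ℝ := (∏ j ∈ Finset.range m, (γ - j)) / m !

/-- The multi-index generalized binomial coefficient, the product of those of the coordinates. -/
def multiBinom {d : ℕ} (γ : Fin d → ℝ) (m : Fin d → ℕ) : ℝ := ∏ i, binom (γ i) (m i)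

/-- The (physicists') Hermite polynomial `H_n`, by Rodrigues' formula. -/
def hermitePoly (n : ℕ) (x : ℝ) : ℝ :=
  (-1) ^ n * Real.exp (x ^ 2) * iteratedDeriv n (fun t : ℝ => Real.exp (-t ^ 2)) x

/-- The Hermite function `h_n` of one variable. -/
def hermiteFun1 (n : ℕ) (x : ℝ) : ℝ :=
  (√(2 ^ n * n ! * √Real.pi))⁻¹ * Real.exp (-x ^ 2 / 2) * hermitePoly n x

/-- The Hermite function `h_n` on `ℝ^d`. -/
def hermiteFun {d : ℕ} (n : Fin d → ℕ) (x : Fin d → ℝ) : ℝ := ∏ i, hermiteFun1 (n i) (x i)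

/-- The Laguerre polynomial `L_n` (of order zero), by Rodrigues' formula. -/
def laguerrePoly (n : ℕ) (x : ℝ) : ℝ :=
  Real.exp x / n ! * iteratedDeriv n (fun t : ℝ => Real.exp (-t) * t ^ n) x

/-- The Laguerre function `l_n` of one variable. -/
def laguerreFun1 (n : ℕ) (x : ℝ) : ℝ := laguerrePoly n x * Real.exp (-x / 2)

/-- The Laguerre function `l_n` of `d` variables. -/
def laguerreFun {d : ℕ} (n : Fin d → ℕ) (x : Fin d → ℝ) : ℝ := ∏ i, laguerreFun1 (n i) (x i)

/-- The open positive orthant `ℝ^d_+ = (0, ∞)^d`. -/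
def orthant (d : ℕ) : Set (Fin d → ℝ) := {x | ∀ i, 0 < x i}

/-- Lebesgue measure on the positive orthant. -/
def orthantMeasure (d : ℕ) : MeasureTheory.Measure (orthant d) :=
  MeasureTheory.Measure.comap Subtype.val MeasureTheory.volume

/-- The map `w(x) = (√x₁, …, √x_d)` of the positive orthant to itself. -/
def w {d : ℕ} (x : orthant d) : orthant d :=
  ⟨fun i => √(x.1 i), fun i => Real.sqrt_pos.2 (x.2 i)⟩

/-- The weight `h^{|n|} (n!)^{1/(2σ)}`. -/
def flatWeight {d : ℕ} (h σ : ℝ) (n : Fin d → ℕ) : ℝ :=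
  h ^ multiLength n * (multiFactorial n : ℝ) ^ (1 / (2 * σ))

/-- The flat sequence space `ℓ_{♭_σ}(ℕ₀^d)`: the union over `h > 0` of the weighted `ℓ^∞` spaces
with weights `flatWeight h σ`. -/
def flatSeq (d : ℕ) (σ : ℝ) : Set ((Fin d → ℕ) → ℂ) :=
  {a | ∃ h : ℝ, 0 < h ∧ BddAbove (Set.range fun n => ‖a n‖ * flatWeight h σ n)}

/-- `f = ∑ a_n h_n` on `ℝ^d`, the series converging absolutely at every point. -/
def HasHermiteExpansion {d : ℕ} (f : (Fin d → ℝ) → ℂ) (a : (Fin d → ℕ) → ℂ) : Prop :=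
  ∀ x, HasSum (fun n => a n * (hermiteFun n x : ℂ)) (f x)

/-- `g = ∑ b_n l_n` on the positive orthant, the series converging absolutely at every point. -/
def HasLaguerreExpansion {d : ℕ} (g : orthant d → ℂ) (b : (Fin d → ℕ) → ℂ) : Prop :=
  ∀ x : orthant d, HasSum (fun n => b n * (laguerreFun n x.1 : ℂ)) (g x)

/-- The flat Pilipović space `H_{♭_σ}(ℝ^d)`. -/
def hermiteFlat (d : ℕ) (σ : ℝ) : Set ((Fin d → ℝ) → ℂ) :=
  {f | ∃ a ∈ flatSeq d σ, HasHermiteExpansion f a}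

/-- The space `H_{♭_σ, even}(ℝ^d)` of functions in `H_{♭_σ}(ℝ^d)` that are even in each variable. -/
def hermiteFlatEven (d : ℕ) (σ : ℝ) : Set ((Fin d → ℝ) → ℂ) :=
  {f | f ∈ hermiteFlat d σ ∧ ∀ (x : Fin d → ℝ) (j : Fin d), f (Function.update x j (-x j)) = f x}

/-- The flat space `G_{♭_σ}(ℝ^d_+)` on the orthant: the functions `∑ b_n l_n` with coefficients
in `ℓ_{♭_{σ/2}}(ℕ₀^d)`. -/
def laguerreFlat (d : ℕ) (σ : ℝ) : Set (orthant d → ℂ) :=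
  {g | ∃ b ∈ flatSeq d (σ / 2), HasLaguerreExpansion g b}

/-- The Laguerre coefficient `∫_{ℝ^d_+} g(x) l_n(x) dx`. -/
def laguerreCoeff {d : ℕ} (g : orthant d → ℂ) (n : Fin d → ℕ) : ℂ :=
  ∫ x, g x * (laguerreFun n x.1 : ℂ) ∂orthantMeasure d

end FlatPilipovic

end

noncomputable section

namespace FlatPilipovic

open MeasureTheory

/-! In one variable `H_{2m}(√x)` is a multiple of the associated Laguerre polynomial
`L_m^{(-1/2)}(x)`, and the connection formula `L_m^{(-1/2)} = ∑_{n ≤ m} binom(m-n-3/2, m-n) L_n`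
passes to order zero. The Gaussian at `√x` is `e^{-x/2}`, so `h_{2m}(√x)` is a finite combination of
`l_0, …, l_m` (`hermiteFun1_two_mul_sqrt`) with coefficients at most `2^m`
(`abs_laguerreOfHermite1_le`).

Evenness removes all Hermite terms except `a_{2m} h_{2m}`. Substituting the finite combinations and
exchanging the sums gives the series for `b_n`, over `m = k + n`. The exchange is legitimate because
`a_{2m}` decays like `R^{|m|} m!^{-1/σ}`, which beats every geometric factor
(`summable_prod_norm_mul_pow`). As `(k+n)! ≥ k! n!`, this decay passes to `b_n` with `R` doubled
(`norm_laguerreTransform_le`); its exponent `1/σ = 1/(2(σ/2))` is that of `ℓ_{♭_{σ/2}}`, which lies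
in `ℓ_{♭_σ}`. Orthonormality of the `l_n` and dominated convergence identify the `b_n` with the
integrals (`HasLaguerreExpansion.laguerreCoeff_eq`). -/

/-! ### Laguerre functions of one variable: explicit form, growth, orthonormality. -/

theorem laguerrePoly_eq_sum (n : ℕ) (x : ℝ) :
    laguerrePoly n x = ∑ i ∈ Finset.range (n + 1), (-1) ^ i * (n.choose i : ℝ) * (x ^ i / i !) := by
  have h1 : ∀ k, iteratedDeriv k (fun t : ℝ => Real.exp (-t)) x = (-1) ^ k * Real.exp (-x) := by
    intro k
    have := congrFun (iteratedDeriv_exp_const_mul k (-1)) x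
    simpa using this
  have h2 : iteratedDeriv n (fun t : ℝ => Real.exp (-t) * t ^ n) x =
      ∑ i ∈ Finset.range (n + 1), (n.choose i : ℝ) * iteratedDeriv i (fun t : ℝ => Real.exp (-t)) x *
        iteratedDeriv (n - i) (fun t : ℝ => t ^ n) x := by
    apply iteratedDeriv_fun_mul
    · fun_prop
    · fun_prop
  rw [laguerrePoly, h2, Finset.mul_sum]
  refine Finset.sum_congr rfl fun i hi => ?_
  have hi' : i ≤ n := Nat.lt_succ_iff.mp (Finset.mem_range.mp hi)
  rw [h1, iteratedDeriv_pow, Nat.sub_sub_self hi', Real.exp_neg]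
  have h3 : (i ! : ℝ) * (n.descFactorial (n - i) : ℝ) = n ! := by
    have := Nat.factorial_mul_descFactorial (Nat.sub_le n i)
    rw [Nat.sub_sub_self hi'] at this
    exact_mod_cast this
  have h4 : (n ! : ℝ) ≠ 0 := by positivity
  have h5 : (i ! : ℝ) ≠ 0 := by positivity
  have h6 := Real.exp_ne_zero x
  field_simp
  linear_combination ((n.choose i : ℝ) * x ^ i) * h3

theorem continuous_laguerreFun1 (n : ℕ) : Continuous (laguerreFun1 n) := by
  unfold laguerreFun1
  simp_rw [laguerrePoly_eq_sum]
  fun_prop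

/-- Bounding `x^i/i!` by `4^i e^{x/4}` spends half of `e^{-x/2}` and gives `5^n = (4+1)^n`; the
remaining `e^{-x/4}` provides integrability. -/
theorem abs_laguerreFun1_le (n : ℕ) {x : ℝ} (hx : 0 < x) :
    |laguerreFun1 n x| ≤ 5 ^ n * Real.exp (-(x / 4)) := by
  have h1 : ∀ i : ℕ, x ^ i / i ! ≤ 4 ^ i * Real.exp (x / 4) := by
    intro i
    have := Real.pow_div_factorial_le_exp (x / 4) (by positivity) i
    calc x ^ i / i ! = 4 ^ i * ((x / 4) ^ i / i !) := by rw [div_pow]; field_simp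
      _ ≤ _ := by gcongr
  have h2 : |laguerrePoly n x| ≤ 5 ^ n * Real.exp (x / 4) := by
    rw [laguerrePoly_eq_sum]
    calc _ ≤ ∑ i ∈ Finset.range (n + 1), |(-1) ^ i * (n.choose i : ℝ) * (x ^ i / i !)| :=
          Finset.abs_sum_le_sum_abs _ _
      _ ≤ ∑ i ∈ Finset.range (n + 1), 4 ^ i * (n.choose i : ℝ) * Real.exp (x / 4) := by
          refine Finset.sum_le_sum fun i _ => ?_
          rw [abs_mul, abs_mul, abs_pow, abs_neg, abs_one, one_pow, one_mul, Nat.abs_cast,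
            abs_of_nonneg (by positivity)]
          calc _ ≤ (n.choose i : ℝ) * (4 ^ i * Real.exp (x / 4)) := by
                gcongr
                exact h1 i
            _ = _ := by ring
      _ = _ := by
          rw [← Finset.sum_mul]
          have := add_pow (4 : ℝ) 1 n
          norm_num at this
          rw [this]
  rw [laguerreFun1, abs_mul, Real.abs_exp]
  calc _ ≤ 5 ^ n * Real.exp (x / 4) * Real.exp (-x / 2) := by gcongr
    _ = _ := by
      rw [mul_assoc, ← Real.exp_add]
      ring_nf

/-- Up to the sign `(-1)^n`, the sum is the `n`-th forward difference of `x ↦ x.choose p` at `x =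
p`. -/
theorem alternating_sum_choose_mul_choose_add (n p : ℕ) :
    ∑ i ∈ Finset.range (n + 1), (-1 : ℤ) ^ i * n.choose i * (i + p).choose p =
      (-1) ^ n * p.choose n := by
  have h := fwdDiff_iter_eq_sum_shift (1 : ℕ) (fun x : ℕ => (x.choose p : ℤ)) n p
  have h2 : (fwdDiff 1)^[n] (fun x : ℕ => (x.choose p : ℤ)) p = p.choose n := by
    rcases le_or_gt n p with hnp | hnp
    · obtain ⟨j, rfl⟩ := Nat.exists_eq_add_of_le hnp
      rw [fwdDiff_iter_choose]
      simp only
      rw [Nat.choose_symm_add]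
    · obtain ⟨j, rfl⟩ := Nat.exists_eq_add_of_lt hnp
      -- After `p` differences the function is the constant 1, and one more annihilates it.
      have e : p + j + 1 = (j + 1) + p := by ring
      have h3 := fwdDiff_iter_choose 0 p
      rw [add_zero] at h3
      rw [e, Function.iterate_add_apply, h3, Nat.choose_eq_zero_of_lt (by omega),
        Function.iterate_succ_apply]
      simp only [Nat.choose_zero_right, Nat.cast_one, fwdDiff_const, Nat.cast_zero]
      simp [fwdDiff_iter_eq_sum_shift]
  rw [h2] at h
  rw [h, Finset.mul_sum]
  refine Finset.sum_congr rfl fun i hi => ?_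
  have hi' : i ≤ n := Nat.lt_succ_iff.mp (Finset.mem_range.mp hi)
  obtain ⟨j, rfl⟩ := Nat.exists_eq_add_of_le hi'
  have h4 : ((-1 : ℤ)) ^ j * (-1) ^ j = 1 := by rw [← mul_pow]; simp
  simp only [smul_eq_mul, mul_one, Nat.add_sub_cancel_left, add_comm p i, pow_add]
  linear_combination (-(-1 : ℤ) ^ i * (i + j).choose i * (i + p).choose p) * h4

theorem integrableOn_pow_mul_exp_neg (j : ℕ) :
    IntegrableOn (fun x : ℝ => x ^ j * Real.exp (-x)) (Set.Ioi 0) := by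
  have := Real.GammaIntegral_convergent (s := (j : ℝ) + 1) (by positivity)
  refine this.congr_fun (fun x _ => ?_) measurableSet_Ioi
  simp [mul_comm]

theorem integral_pow_mul_exp_neg (j : ℕ) :
    ∫ x in Set.Ioi (0 : ℝ), x ^ j * Real.exp (-x) = j ! := by
  rw [← Real.Gamma_nat_eq_factorial, Real.Gamma_eq_integral (by positivity)]
  refine setIntegral_congr_fun measurableSet_Ioi (fun x _ => ?_)
  simp [mul_comm]

theorem laguerreFun1_mul (m n : ℕ) (x : ℝ) :
    laguerreFun1 m x * laguerreFun1 n x = ∑ p ∈ Finset.range (m + 1), ∑ i ∈ Finset.range (n + 1),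
      ((-1) ^ p * (m.choose p : ℝ) / p ! * ((-1) ^ i * (n.choose i : ℝ) / i !)) *
        (x ^ (i + p) * Real.exp (-x)) := by
  have h : Real.exp (-x) = Real.exp (-x / 2) * Real.exp (-x / 2) := by
    rw [← Real.exp_add]; ring_nf
  rw [laguerreFun1, laguerreFun1, laguerrePoly_eq_sum, laguerrePoly_eq_sum, h, mul_mul_mul_comm,
    Finset.sum_mul_sum, Finset.sum_mul]
  refine Finset.sum_congr rfl fun p _ => ?_
  rw [Finset.sum_mul]
  refine Finset.sum_congr rfl fun i _ => ?_
  ring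

/-- Termwise Gamma integrals reduce the inner sum to the previous alternating identity; the outer
sum is then, up to sign, the `m`-th difference of `x.choose n` at 0. -/
theorem integral_laguerreFun1_mul (m n : ℕ) :
    ∫ x in Set.Ioi (0 : ℝ), laguerreFun1 m x * laguerreFun1 n x = if m = n then 1 else 0 := by
  simp_rw [laguerreFun1_mul]
  rw [integral_finsetSum _ fun p _ => integrable_finsetSum _ fun i _ =>
    (integrableOn_pow_mul_exp_neg (i + p)).const_mul _]
  have h1 : ∀ p ∈ Finset.range (m + 1), ∫ x in Set.Ioi (0 : ℝ), ∑ i ∈ Finset.range (n + 1),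
      ((-1) ^ p * (m.choose p : ℝ) / p ! * ((-1) ^ i * (n.choose i : ℝ) / i !)) *
        (x ^ (i + p) * Real.exp (-x)) =
      (((-1 : ℤ) ^ p * m.choose p * ((-1) ^ n * p.choose n) : ℤ) : ℝ) := by
    intro p _
    rw [integral_finsetSum _ fun i _ => (integrableOn_pow_mul_exp_neg (i + p)).const_mul _,
      ← alternating_sum_choose_mul_choose_add n p, Finset.mul_sum, Int.cast_sum]
    refine Finset.sum_congr rfl fun i _ => ?_
    rw [integral_const_mul, integral_pow_mul_exp_neg]
    have h2 : ((i + p).choose p : ℝ) * i ! * p ! = (i + p)! := by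
      have := Nat.add_choose_mul_factorial_mul_factorial i p
      exact_mod_cast this
    rw [← h2]
    push_cast
    field_simp
  rw [Finset.sum_congr rfl h1, ← Int.cast_sum]
  have h := fwdDiff_iter_eq_sum_shift (1 : ℕ) (fun x : ℕ => (x.choose n : ℤ)) m 0
  rw [fwdDiff_iter_choose_zero] at h
  have h3 : ∑ p ∈ Finset.range (m + 1), (-1 : ℤ) ^ p * m.choose p * ((-1) ^ n * p.choose n) =
      (-1) ^ (m + n) * if m = n then 1 else 0 := by
    rw [h, Finset.mul_sum]
    refine Finset.sum_congr rfl fun p hp => ?_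
    obtain ⟨j, rfl⟩ := Nat.exists_eq_add_of_le (Nat.lt_succ_iff.mp (Finset.mem_range.mp hp))
    have h4 : ((-1 : ℤ)) ^ j * (-1) ^ j = 1 := by rw [← mul_pow]; simp
    simp only [smul_eq_mul, mul_one, Nat.add_sub_cancel_left, zero_add, pow_add]
    linear_combination (-(-1 : ℤ) ^ p * (-1) ^ n * (p + j).choose p * p.choose n) * h4
  rw [h3]
  split_ifs with hmn
  · subst hmn
    simp [← two_mul]
  · simp

/-! ### Generalized binomial coefficients and the connection formula. -/

theorem binom_eq_ringChoose (γ : ℝ) (m : ℕ) : binom γ m = Ring.choose γ m := by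
  rw [Ring.choose_eq_smul, ← Polynomial.aeval_eq_smeval, binom, smul_eq_mul,
    Polynomial.aeval_def, Polynomial.eval₂_eq_eval_map, descPochhammer_map, descPochhammer_eval_eq_prod_range, div_eq_inv_mul]

theorem binom_add (r s : ℝ) (k : ℕ) :
    binom (r + s) k = ∑ i ∈ Finset.range (k + 1), binom r (k - i) * binom s i := by
  rw [binom_eq_ringChoose, Ring.add_choose_eq k (Commute.all r s),
    Finset.Nat.sum_antidiagonal_eq_sum_range_succ (fun i j => Ring.choose r i * Ring.choose s j),
    ← Finset.sum_range_reflect]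
  refine Finset.sum_congr rfl fun i hi => ?_
  have hi' : i ≤ k := Nat.lt_succ_iff.mp (Finset.mem_range.mp hi)
  rw [binom_eq_ringChoose, binom_eq_ringChoose]
  congr 2
  omega

theorem binom_reflect (γ : ℝ) (k : ℕ) : binom (k - 1 - γ) k = (-1) ^ k * binom γ k := by
  rw [binom, binom, ← mul_div_assoc]
  congr 1
  have h : ((-1 : ℝ)) ^ k = ∏ _j ∈ Finset.range k, (-1 : ℝ) := by simp
  rw [← Finset.prod_range_reflect, h, ← Finset.prod_mul_distrib]
  refine Finset.prod_congr rfl fun j hj => ?_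
  have hj' : j < k := Finset.mem_range.mp hj
  rw [Nat.cast_sub (by omega), Nat.cast_sub (by omega)]
  push_cast
  ring

theorem binom_natCast (n k : ℕ) : binom (n : ℝ) k = n.choose k := by
  rw [binom_eq_ringChoose, Ring.choose_natCast]

/-- Chu–Vandermonde with upper entries `1/2` and `-(j+1)`, each factor being rewritten by
`binom_reflect`. -/
theorem sum_binom_mul_choose_add (s j : ℕ) :
    ∑ r ∈ Finset.range (s + 1), binom ((s - r : ℕ) - 3 / 2) (s - r) * ((j + r).choose j : ℝ) =
      binom ((s + j : ℕ) - 1 / 2) s := by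
  have h0 : ((s + j : ℕ) : ℝ) - 1 / 2 = s - 1 - (1 / 2 + -((j : ℝ) + 1)) := by push_cast; ring
  rw [h0, binom_reflect, binom_add, Finset.mul_sum]
  refine Finset.sum_congr rfl fun r hr => ?_
  have hr' : r ≤ s := Nat.lt_succ_iff.mp (Finset.mem_range.mp hr)
  have h1 : ((s - r : ℕ) : ℝ) - 3 / 2 = (s - r : ℕ) - 1 - 1 / 2 := by ring
  have h2 : ((j + r).choose j : ℝ) = (-1) ^ r * binom (-((j : ℝ) + 1)) r := by
    rw [Nat.choose_symm_add, ← binom_natCast, ← binom_reflect]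
    congr 1
    push_cast
    ring
  rw [h1, binom_reflect, h2]
  have h3 : ((-1 : ℝ)) ^ s = (-1) ^ (s - r) * (-1) ^ r := by
    rw [← pow_add, Nat.sub_add_cancel hr']
  rw [h3]
  ring

/-- By reflection this is `|binom (1/2) k|`, and `|1/2 - j| ≤ j + 1` factor by factor against `k!`.
-/
theorem abs_binom_sub_three_halves_le (k : ℕ) : |binom ((k : ℝ) - 3 / 2) k| ≤ 1 := by
  have h0 : (k : ℝ) - 3 / 2 = k - 1 - 1 / 2 := by ring
  rw [h0, binom_reflect, abs_mul, abs_pow, abs_neg, abs_one, one_pow, one_mul, binom, abs_div,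
    Nat.abs_cast, div_le_one (by positivity), Finset.abs_prod, ← Finset.prod_range_add_one_eq_factorial,
    Nat.cast_prod]
  refine Finset.prod_le_prod (fun _ _ => abs_nonneg _) fun j _ => ?_
  have : (0 : ℝ) ≤ j := j.cast_nonneg
  push_cast
  rw [abs_le]
  constructor <;> linarith

theorem sum_binom_mul_choose (m j : ℕ) (hj : j ≤ m) :
    ∑ n ∈ Finset.range (m + 1), binom ((m - n : ℕ) - 3 / 2) (m - n) * (n.choose j : ℝ) =
      binom ((m : ℝ) - 1 / 2) (m - j) := by
  obtain ⟨s, rfl⟩ := Nat.exists_eq_add_of_le hj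
  rw [add_assoc, Finset.sum_range_add, Finset.sum_eq_zero, zero_add]
  · have := sum_binom_mul_choose_add s j
    rw [Nat.add_comm s j] at this
    rw [Nat.add_sub_cancel_left, ← this]
    refine Finset.sum_congr rfl fun r _ => ?_
    rw [Nat.add_sub_add_left]
  · intro n hn
    rw [Nat.choose_eq_zero_of_lt (Finset.mem_range.mp hn)]
    simp

/-- The right side is `L_m^{(-1/2)}(x)`; the formula is checked on the coefficient of each `x^j`. -/
theorem sum_binom_mul_laguerrePoly (m : ℕ) (x : ℝ) :
    ∑ n ∈ Finset.range (m + 1), binom ((m - n : ℕ) - 3 / 2) (m - n) * laguerrePoly n x =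
      ∑ j ∈ Finset.range (m + 1), (-1) ^ j * binom ((m : ℝ) - 1 / 2) (m - j) * (x ^ j / j !) := by
  have h : ∀ n ∈ Finset.range (m + 1), laguerrePoly n x =
      ∑ j ∈ Finset.range (m + 1), (-1) ^ j * (n.choose j : ℝ) * (x ^ j / j !) := by
    intro n hn
    rw [laguerrePoly_eq_sum]
    refine Finset.sum_subset (Finset.range_mono (Finset.mem_range.mp hn)) fun j _ hj => ?_
    rw [Nat.choose_eq_zero_of_lt (by simpa using hj)]
    simp
  rw [Finset.sum_congr rfl fun n hn => congrArg _ (h n hn)]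
  simp_rw [Finset.mul_sum]
  rw [Finset.sum_comm]
  refine Finset.sum_congr rfl fun j hj => ?_
  rw [← sum_binom_mul_choose m j (Nat.lt_succ_iff.mp (Finset.mem_range.mp hj)), Finset.mul_sum,
    Finset.sum_mul]
  refine Finset.sum_congr rfl fun n _ => ?_
  ring

/-! ### Even Hermite functions as finite Laguerre sums. -/

/-- `Polynomial.hermite` is the probabilists' polynomial, attached to `e^{-y²/2}`; the substitution
`y = √2 x` costs one `√2` per derivative. -/
theorem hermitePoly_eq_aeval (n : ℕ) (x : ℝ) :
    hermitePoly n x = √2 ^ n * Polynomial.aeval (√2 * x) (Polynomial.hermite n) := by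
  have h0 : (fun t : ℝ => Real.exp (-t ^ 2)) =
      fun t => (fun y : ℝ => Real.exp (-(y ^ 2 / 2))) (√2 * t) := by
    funext t
    simp only
    rw [mul_pow, Real.sq_sqrt (by norm_num)]
    ring_nf
  have hc : ContDiff ℝ n (fun y : ℝ => Real.exp (-(y ^ 2 / 2))) := by fun_prop
  rw [hermitePoly, h0, congrFun (iteratedDeriv_comp_const_mul hc (√2)) x, iteratedDeriv_eq_iterate,
    Polynomial.deriv_gaussian_eq_hermite_mul_gaussian, mul_pow, Real.sq_sqrt (by norm_num)]
  have h1 : ((-1 : ℝ)) ^ n * (-1) ^ n = 1 := by rw [← mul_pow]; simp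
  have h2 : Real.exp (x ^ 2) * Real.exp (-(2 * x ^ 2 / 2)) = 1 := by
    rw [← Real.exp_add]; ring_nf; simp
  linear_combination (√2 ^ n * Polynomial.aeval (√2 * x) (Polynomial.hermite n)) *
    (h1 * (Real.exp (x ^ 2) * Real.exp (-(2 * x ^ 2 / 2))) + h2)

theorem sum_range_two_mul_add_one_of_odd_eq_zero (f : ℕ → ℝ) (hf : ∀ j, f (2 * j + 1) = 0) (m : ℕ) :
    ∑ k ∈ Finset.range (2 * m + 1), f k = ∑ j ∈ Finset.range (m + 1), f (2 * j) := by
  induction m with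
  | zero => simp
  | succ m ih =>
    rw [show 2 * (m + 1) + 1 = 2 * m + 1 + 1 + 1 by ring, Finset.sum_range_succ,
      Finset.sum_range_succ, ih, hf, Finset.sum_range_succ _ (m + 1), add_zero]
    rfl

/-- Splits `(2(j+s))!/(2j)!` into even and odd factors; the odd ones give the product of `j + 1/2 +
i` over `i < s`. -/
theorem factorial_two_mul_add_mul_factorial (j s : ℕ) :
    ((2 * (j + s))! : ℝ) * j ! = 4 ^ s * (j + s)! * (2 * j)! *
      (s ! * binom ((j + s : ℕ) - 1 / 2) s) := by
  have h : ∀ s : ℕ, (s ! : ℝ) * binom ((j + s : ℕ) - 1 / 2) s =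
      ∏ i ∈ Finset.range s, ((j : ℝ) + 1 / 2 + i) := by
    intro s
    have h0 : (s ! : ℝ) ≠ 0 := by positivity
    rw [binom, mul_div_cancel₀ _ h0, ← Finset.prod_range_reflect]
    refine Finset.prod_congr rfl fun i hi => ?_
    have hi' : i < s := Finset.mem_range.mp hi
    rw [Nat.cast_sub (by omega), Nat.cast_sub (by omega)]
    push_cast
    ring
  rw [h]
  induction s with
  | zero => simp; ring
  | succ s ih =>
    rw [Finset.prod_range_succ, show 2 * (j + (s + 1)) = 2 * (j + s) + 1 + 1 by ring,
      Nat.factorial_succ, Nat.factorial_succ, ← add_assoc j s 1, Nat.factorial_succ (j + s)]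
    push_cast
    linear_combination ((2 * ((j : ℝ) + s) + 1 + 1) * (2 * (j + s) + 1)) * ih

/-- Coefficients of `y^{2j}` are compared with `s = m - j`: the explicit `(2s-1)‼ * choose` becomes
the half-integer binomial by the preceding factorial identity. -/
theorem hermitePoly_two_mul (m : ℕ) (y : ℝ) :
    hermitePoly (2 * m) y = (-1) ^ m * 4 ^ m * m ! * ∑ j ∈ Finset.range (m + 1),
      (-1) ^ j * binom ((m : ℝ) - 1 / 2) (m - j) * ((y ^ 2) ^ j / j !) := by
  rw [hermitePoly_eq_aeval, Polynomial.aeval_eq_sum_range' (n := 2 * m + 1)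
    (by rw [Polynomial.natDegree_hermite]; omega), sum_range_two_mul_add_one_of_odd_eq_zero,
    Finset.mul_sum, Finset.mul_sum]
  · refine Finset.sum_congr rfl fun j hj => ?_
    obtain ⟨s, rfl⟩ := Nat.exists_eq_add_of_le (Nat.lt_succ_iff.mp (Finset.mem_range.mp hj))
    have h1 := Polynomial.coeff_hermite_explicit s (2 * j)
    rw [show 2 * s + 2 * j = 2 * (j + s) by ring] at h1
    rw [h1, zsmul_eq_mul, pow_mul, pow_mul, mul_pow √2, Real.sq_sqrt (by norm_num), mul_pow,
      Nat.add_sub_cancel_left]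
    push_cast
    have h2 : ((2 * (j + s)).choose (2 * j) : ℝ) * (2 * j)! * (2 * s)! = (2 * (j + s))! := by
      have := Nat.add_choose_mul_factorial_mul_factorial (2 * s) (2 * j)
      rw [show 2 * s + 2 * j = 2 * (j + s) by ring] at this
      have := congrArg (Nat.cast (R := ℝ)) this
      push_cast at this
      linear_combination this
    have h3 : ((2 * s)! : ℝ) = (2 * s - 1)‼ * (2 ^ s * s !) := by
      have h4 : (2 * s)! = (2 * s)‼ * (2 * s - 1)‼ := by
        rcases s with _ | s
        · rfl
        · exact Nat.factorial_eq_mul_doubleFactorial (2 * s + 1)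
      rw [h4, Nat.doubleFactorial_two_mul]
      push_cast
      ring
    have h5 := factorial_two_mul_add_mul_factorial j s
    have e1 : ((-1 : ℝ)) ^ j * (-1) ^ j = 1 := by rw [← mul_pow]; simp
    have p1 : (0 : ℝ) < j ! := by positivity
    have p2 : (0 : ℝ) < (2 * j)! := by positivity
    have p3 : (0 : ℝ) < s ! := by positivity
    have p4 : (0 : ℝ) < (2 : ℝ) ^ s := by positivity
    have h6 : ((2 * s - 1)‼ : ℝ) * ((2 * (j + s)).choose (2 * j)) * 2 ^ s * j ! =
        4 ^ s * (j + s)! * binom ((j + s : ℕ) - 1 / 2) s := by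
      have : ((2 * s - 1)‼ : ℝ) * ((2 * (j + s)).choose (2 * j)) * 2 ^ s * j ! * ((2 * j)! * s !) =
        4 ^ s * (j + s)! * binom ((j + s : ℕ) - 1 / 2) s * ((2 * j)! * s !) := by
        rw [h3] at h2
        rw [← h2] at h5
        linear_combination h5
      exact mul_right_cancel₀ (by positivity) this
    rw [show (4 : ℝ) = 2 * 2 by norm_num, mul_pow] at h6 ⊢
    push_cast at h6
    field_simp
    have h7 : ((2 * s - 1)‼ : ℝ) * ((2 * (j + s)).choose (2 * j)) * j ! =
        2 ^ s * (j + s)! * binom ((j : ℝ) + s - 1 / 2) s := by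
      apply mul_right_cancel₀ p4.ne'
      linear_combination h6
    rw [show (((j : ℝ) + s) * 2 - 1) / 2 = j + s - 1 / 2 by ring, pow_add, pow_add]
    linear_combination ((-1 : ℝ) ^ s * 2 ^ j * (y ^ 2) ^ j) * h7 -
      ((-1 : ℝ) ^ s * 2 ^ j * (y ^ 2) ^ j *
        (2 ^ s * (j + s)! * binom ((j : ℝ) + s - 1 / 2) s)) * e1
  · intro j
    rw [Polynomial.coeff_hermite_of_odd_add]
    · simp
    · exact ⟨m + j, by ring⟩

theorem hermitePoly_two_mul_sqrt (m : ℕ) {x : ℝ} (hx : 0 < x) :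
    hermitePoly (2 * m) √x = (-1) ^ m * 4 ^ m * m ! * ∑ n ∈ Finset.range (m + 1),
      binom ((m - n : ℕ) - 3 / 2) (m - n) * laguerrePoly n x := by
  rw [hermitePoly_two_mul, sum_binom_mul_laguerrePoly, Real.sq_sqrt hx.le]

/-- The coefficient of `l_n` in the expansion of `h_{2m}(√x)` in Laguerre functions. -/
def laguerreOfHermite1 (m n : ℕ) : ℝ :=
  if n ≤ m then (Real.pi ^ ((1 : ℝ) / 4))⁻¹ * (-1) ^ m * 2 ^ m * m ! / √((2 * m)! : ℝ) *
    binom ((m - n : ℕ) - 3 / 2) (m - n) else 0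

theorem hermiteFun1_two_mul_sqrt (m : ℕ) {x : ℝ} (hx : 0 < x) :
    hermiteFun1 (2 * m) √x =
      ∑ n ∈ Finset.range (m + 1), laguerreOfHermite1 m n * laguerreFun1 n x := by
  have h1 : √(2 ^ (2 * m) * (2 * m)! * √Real.pi) =
      2 ^ m * √((2 * m)! : ℝ) * Real.pi ^ ((1 : ℝ) / 4) := by
    rw [Real.sqrt_mul (by positivity), Real.sqrt_mul (by positivity), mul_comm 2 m, pow_mul,
      Real.sqrt_sq (by positivity)]
    congr 1
    rw [Real.sqrt_eq_rpow, Real.sqrt_eq_rpow, ← Real.rpow_mul Real.pi_pos.le]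
    norm_num
  rw [hermiteFun1, hermitePoly_two_mul_sqrt m hx, h1, Real.sq_sqrt hx.le, Finset.mul_sum,
    Finset.mul_sum]
  refine Finset.sum_congr rfl fun n hn => ?_
  rw [laguerreOfHermite1, if_pos (Nat.lt_succ_iff.mp (Finset.mem_range.mp hn)), laguerreFun1,
    show (4 : ℝ) = 2 * 2 by norm_num, mul_pow]
  have p1 : √((2 * m)! : ℝ) ≠ 0 := by positivity
  have p2 : Real.pi ^ ((1 : ℝ) / 4) ≠ 0 := by positivity
  field_simp

theorem factorial_div_sqrt_factorial_two_mul_le (m : ℕ) : (m ! : ℝ) / √((2 * m)! : ℝ) ≤ 1 := by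
  rw [div_le_one (by positivity)]
  apply Real.le_sqrt_of_sq_le
  have := Nat.le_of_dvd (by positivity) (Nat.factorial_mul_factorial_dvd_factorial_add m m)
  rw [← two_mul] at this
  rw [sq]
  exact_mod_cast this

theorem abs_laguerreOfHermite1_le (m n : ℕ) : |laguerreOfHermite1 m n| ≤ 2 ^ m := by
  rw [laguerreOfHermite1]
  split_ifs with h
  · have h1 : (1 : ℝ) ≤ Real.pi ^ ((1 : ℝ) / 4) :=
      Real.one_le_rpow (by linarith [Real.pi_gt_three]) (by norm_num)
    have h2 := factorial_div_sqrt_factorial_two_mul_le m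
    have h3 := abs_binom_sub_three_halves_le (m - n)
    rw [mul_div_assoc, abs_mul, abs_mul, abs_mul, abs_mul, abs_pow, abs_neg, abs_one, one_pow,
      mul_one, abs_of_nonneg (by positivity), abs_of_nonneg (by positivity),
      abs_of_nonneg (by positivity)]
    calc _ ≤ (1 : ℝ) * 2 ^ m * 1 * 1 := by
          gcongr
          exact inv_le_one_of_one_le₀ h1
      _ = _ := by ring
  · simp

theorem laguerreOfHermite1_of_lt {m n : ℕ} (h : m < n) : laguerreOfHermite1 m n = 0 :=
  if_neg (by omega)

theorem hermiteFun1_neg (n : ℕ) (x : ℝ) : hermiteFun1 n (-x) = (-1) ^ n * hermiteFun1 n x := by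
  have h := iteratedDeriv_comp_neg n (fun t : ℝ => Real.exp (-t ^ 2)) (-x)
  simp only [neg_sq, neg_neg, smul_eq_mul] at h
  rw [hermiteFun1, hermiteFun1, hermitePoly, hermitePoly, h, neg_sq]
  ring

/-! ### Factorial decay and the flat sequence spaces. -/

/-- The super-exponentially decaying sequence `R^m (m!)^{-s}`. -/
def flatDecay (R s : ℝ) (m : ℕ) : ℝ := R ^ m * (m ! : ℝ) ^ (-s)

theorem flatDecay_nonneg {R : ℝ} (hR : 0 ≤ R) (s : ℝ) (m : ℕ) : 0 ≤ flatDecay R s m := by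
  unfold flatDecay; positivity

theorem flatDecay_pos {R : ℝ} (hR : 0 < R) (s : ℝ) (m : ℕ) : 0 < flatDecay R s m := by
  unfold flatDecay; positivity

theorem mul_flatDecay (c R s : ℝ) (m : ℕ) : c ^ m * flatDecay R s m = flatDecay (c * R) s m := by
  rw [flatDecay, flatDecay, mul_pow, mul_assoc]

theorem flatDecay_add_le {R s : ℝ} (hR : 0 ≤ R) (hs : 0 ≤ s) (m n : ℕ) :
    flatDecay R s (m + n) ≤ flatDecay R s m * flatDecay R s n := by
  have h : ((m + n)! : ℝ) ^ (-s) ≤ ((m ! : ℝ) * n !) ^ (-s) := by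
    apply Real.rpow_le_rpow_of_nonpos (by positivity) _ (by linarith)
    exact_mod_cast Nat.le_of_dvd (by positivity) (Nat.factorial_mul_factorial_dvd_factorial_add m n)
  rw [Real.mul_rpow (by positivity) (by positivity)] at h
  rw [flatDecay, flatDecay, flatDecay]
  calc _ ≤ R ^ (m + n) * ((m ! : ℝ) ^ (-s) * (n ! : ℝ) ^ (-s)) := by gcongr
    _ = _ := by ring

theorem summable_flatDecay {R s : ℝ} (hR : 0 < R) (hs : 0 < s) : Summable (flatDecay R s) := by
  refine summable_of_ratio_test_tendsto_lt_one (l := 0) one_pos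
    (Filter.Eventually.of_forall fun m => (flatDecay_pos hR s m).ne') ?_
  have h : ∀ m : ℕ, ‖flatDecay R s (m + 1)‖ / ‖flatDecay R s m‖ = R * ((m + 1 : ℕ) : ℝ) ^ (-s) := by
    intro m
    rw [Real.norm_of_nonneg (flatDecay_nonneg hR.le _ _),
      Real.norm_of_nonneg (flatDecay_nonneg hR.le _ _), div_eq_iff (flatDecay_pos hR s m).ne',
      flatDecay, flatDecay, Nat.factorial_succ, Nat.cast_mul,
      Real.mul_rpow (by positivity) (by positivity)]
    ring
  simp_rw [h]
  have h2 := ((tendsto_rpow_neg_atTop hs).comp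
    (tendsto_natCast_atTop_atTop.comp (Filter.tendsto_add_atTop_nat 1))).const_mul R
  simpa using h2

/-- Any finite set of multi-indices lies in a box, over which the sum factors. -/
theorem summable_prod_apply {d : ℕ} {f : ℕ → ℝ} (hf : ∀ n, 0 ≤ f n) (hs : Summable f) :
    Summable fun n : Fin d → ℕ => ∏ i, f (n i) := by
  refine summable_of_sum_le (c := (∑' n, f n) ^ d) (fun n => Finset.prod_nonneg fun i _ => hf _)
    fun u => ?_
  let N : Fin d → Finset ℕ := fun i => u.image fun n => n i
  calc ∑ n ∈ u, ∏ i, f (n i) ≤ ∑ n ∈ Fintype.piFinset N, ∏ i, f (n i) := by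
        refine Finset.sum_le_sum_of_subset_of_nonneg (fun n hn => ?_) fun n _ _ =>
          Finset.prod_nonneg fun i _ => hf _
        exact Fintype.mem_piFinset.mpr fun i => Finset.mem_image_of_mem (fun n => n i) hn
    _ = ∏ i, ∑ j ∈ N i, f j := (Finset.prod_univ_sum N fun _ j => f j).symm
    _ ≤ ∏ _i : Fin d, ∑' n, f n := Finset.prod_le_prod
        (fun i _ => Finset.sum_nonneg fun j _ => hf j)
        fun i _ => hs.sum_le_tsum _ fun j _ => hf j
    _ = _ := by simp

theorem flatWeight_eq_prod {d : ℕ} (h σ : ℝ) (n : Fin d → ℕ) :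
    flatWeight h σ n = ∏ i, (h ^ n i * ((n i)! : ℝ) ^ (1 / (2 * σ))) := by
  rw [flatWeight, multiLength, multiFactorial, Finset.prod_mul_distrib, Finset.prod_pow_eq_pow_sum,
    Nat.cast_prod, Real.finsetProd_rpow _ _ fun i _ => by positivity]

/-- The gain from `σ` to `σ/2` comes from here: `(m!)² ≤ (2m)!` turns the exponent `1/(2σ)` at `2m`
into `1/σ` at `m`, and `|2m| = 2|m|` gives `R = h⁻²`. -/
theorem norm_two_smul_le_of_mem_flatSeq {d : ℕ} {σ : ℝ} (hσ : 0 < σ) {a : (Fin d → ℕ) → ℂ}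
    (ha : a ∈ flatSeq d σ) :
    ∃ K R : ℝ, 0 ≤ K ∧ 0 < R ∧ ∀ m, ‖a (2 • m)‖ ≤ K * ∏ i, flatDecay R (1 / σ) (m i) := by
  obtain ⟨h, hh, B, hB⟩ := ha
  have hB' : ∀ n, ‖a n‖ * flatWeight h σ n ≤ B := fun n => hB ⟨n, rfl⟩
  have hw : ∀ n : Fin d → ℕ, 0 < flatWeight h σ n := fun n => by
    rw [flatWeight_eq_prod]; exact Finset.prod_pos fun i _ => by positivity
  have hB0 : 0 ≤ B := le_trans (mul_nonneg (norm_nonneg _) (hw 0).le) (hB' 0)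
  refine ⟨B, (h ^ 2)⁻¹, hB0, by positivity, fun m => ?_⟩
  have h1 : (∏ i, flatDecay (h ^ 2)⁻¹ (1 / σ) (m i))⁻¹ ≤ flatWeight h σ (2 • m) := by
    rw [flatWeight_eq_prod, ← Finset.prod_inv_distrib]
    refine Finset.prod_le_prod (fun i _ => ?_) fun i _ => ?_
    · exact inv_nonneg.mpr (flatDecay_nonneg (by positivity) _ _)
    · rw [flatDecay, mul_inv, Real.rpow_neg (by positivity), inv_inv, inv_pow, inv_inv, ← pow_mul]
      have h2 : ((m i)! : ℝ) ^ (2 : ℕ) ≤ ((2 * m i)! : ℝ) := by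
        have := Nat.le_of_dvd (by positivity) (Nat.factorial_mul_factorial_dvd_factorial_add (m i) (m i))
        rw [← two_mul, ← sq] at this
        exact_mod_cast this
      have h3 : ((m i)! : ℝ) ^ (1 / σ) = (((m i)! : ℝ) ^ (2 : ℕ)) ^ (1 / (2 * σ)) := by
        rw [← Real.rpow_natCast, ← Real.rpow_mul (by positivity)]
        congr 1
        push_cast
        field_simp
      rw [h3]
      simp only [Pi.smul_apply, smul_eq_mul]
      gcongr
  have hp : 0 < ∏ i, flatDecay (h ^ 2)⁻¹ (1 / σ) (m i) :=
    Finset.prod_pos fun i _ => flatDecay_pos (by positivity) _ _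
  have h4 := (mul_le_mul_of_nonneg_left h1 (norm_nonneg (a (2 • m)))).trans (hB' _)
  rwa [← div_eq_mul_inv, div_le_iff₀ hp] at h4

theorem mem_flatSeq_of_norm_le {d : ℕ} {τ s K R : ℝ} (hR : 0 < R) (hτ : 1 / (2 * τ) ≤ s)
    {b : (Fin d → ℕ) → ℂ} (hb : ∀ n, ‖b n‖ ≤ K * ∏ i, flatDecay R s (n i)) : b ∈ flatSeq d τ := by
  have hK : 0 ≤ K := by
    have h0 := (norm_nonneg _).trans (hb 0)
    exact nonneg_of_mul_nonneg_left h0 (Finset.prod_pos fun i _ => flatDecay_pos hR _ _)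
  refine ⟨R⁻¹, by positivity, K, ?_⟩
  rintro _ ⟨n, rfl⟩
  have hw : 0 ≤ flatWeight R⁻¹ τ n := by
    rw [flatWeight_eq_prod]; exact Finset.prod_nonneg fun i _ => by positivity
  calc ‖b n‖ * flatWeight R⁻¹ τ n
      ≤ (K * ∏ i, flatDecay R s (n i)) * flatWeight R⁻¹ τ n := by gcongr; exact hb n
    _ = K * ∏ i, (flatDecay R s (n i) * (R⁻¹ ^ n i * ((n i)! : ℝ) ^ (1 / (2 * τ)))) := by
        rw [flatWeight_eq_prod, mul_assoc, ← Finset.prod_mul_distrib]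
    _ ≤ K * ∏ _i : Fin d, (1 : ℝ) := by
        gcongr with i
        · exact fun i _ => mul_nonneg (flatDecay_nonneg hR.le _ _) (by positivity)
        · have h1 : ((n i)! : ℝ) ^ (1 / (2 * τ)) ≤ ((n i)! : ℝ) ^ s :=
            Real.rpow_le_rpow_of_exponent_le (Nat.one_le_cast.mpr (Nat.factorial_pos _)) hτ
          have h2 : ((n i)! : ℝ) ^ (-s) * ((n i)! : ℝ) ^ s = 1 := by
            rw [← Real.rpow_add (by positivity)]; simp
          have h3 : R ^ n i * R⁻¹ ^ n i = 1 := by rw [← mul_pow, mul_inv_cancel₀ hR.ne', one_pow]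
          calc flatDecay R s (n i) * (R⁻¹ ^ n i * ((n i)! : ℝ) ^ (1 / (2 * τ)))
              = (R ^ n i * R⁻¹ ^ n i) * (((n i)! : ℝ) ^ (-s) * ((n i)! : ℝ) ^ (1 / (2 * τ))) := by
                rw [flatDecay]; ring
            _ ≤ 1 * (((n i)! : ℝ) ^ (-s) * ((n i)! : ℝ) ^ s) := by rw [h3]; gcongr
            _ = 1 := by rw [h2, one_mul]
    _ = K := by simp

/-! ### The coefficient transform and the exchange of sums. -/

/-- The coefficient of `l_n` in the expansion of `h_{2m} ∘ w` in Laguerre functions. -/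
def laguerreOfHermite {d : ℕ} (m n : Fin d → ℕ) : ℝ := ∏ i, laguerreOfHermite1 (m i) (n i)

theorem hasSum_hermiteFun_two_smul_w {d : ℕ} (m : Fin d → ℕ) (x : orthant d) :
    HasSum (fun n => laguerreOfHermite m n * laguerreFun n x.1) (hermiteFun (2 • m) (w x).1) := by
  have h : hermiteFun (2 • m) (w x).1 =
      ∑ n ∈ Fintype.piFinset fun i => Finset.range (m i + 1),
        laguerreOfHermite m n * laguerreFun n x.1 := by
    simp_rw [laguerreOfHermite, laguerreFun, ← Finset.prod_mul_distrib]
    rw [hermiteFun, ← Finset.prod_univ_sum (fun i => Finset.range (m i + 1))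
      fun i j => laguerreOfHermite1 (m i) j * laguerreFun1 j (x.1 i)]
    exact Finset.prod_congr rfl fun i _ => hermiteFun1_two_mul_sqrt (m i) (x.2 i)
  rw [h]
  refine hasSum_sum_of_ne_finset_zero fun n hn => ?_
  rw [Fintype.mem_piFinset] at hn
  push Not at hn
  obtain ⟨i, hi⟩ := hn
  rw [laguerreOfHermite, Finset.prod_eq_zero (Finset.mem_univ i), zero_mul]
  exact laguerreOfHermite1_of_lt (by simpa using hi)

theorem abs_laguerreOfHermite_le {d : ℕ} (m n : Fin d → ℕ) :
    |laguerreOfHermite m n| ≤ ∏ i, 2 ^ m i := by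
  rw [laguerreOfHermite, Finset.abs_prod]
  exact Finset.prod_le_prod (fun _ _ => abs_nonneg _) fun i _ => abs_laguerreOfHermite1_le _ _

/-- The coefficient vanishes unless `n ≤ m`, so `5^n = 10^n 2^{-n} ≤ 10^m 2^{-n}`: growth in `n` is
traded for growth in `m`, leaving a factor summable in `n`. -/
theorem abs_laguerreOfHermite_mul_le {d : ℕ} (m n : Fin d → ℕ) :
    |laguerreOfHermite m n| * ∏ i, 5 ^ n i ≤ (∏ i, 20 ^ m i) * ∏ i, (1 / 2 : ℝ) ^ n i := by
  rw [laguerreOfHermite, Finset.abs_prod, ← Finset.prod_mul_distrib, ← Finset.prod_mul_distrib]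
  refine Finset.prod_le_prod (fun _ _ => by positivity) fun i _ => ?_
  rcases lt_or_ge (m i) (n i) with h | h
  · rw [laguerreOfHermite1_of_lt h]; simp
  · calc |laguerreOfHermite1 (m i) (n i)| * 5 ^ n i
        ≤ 2 ^ m i * 5 ^ n i := by gcongr; exact abs_laguerreOfHermite1_le _ _
      _ = 2 ^ m i * (10 ^ n i * (1 / 2 : ℝ) ^ n i) := by rw [← mul_pow]; norm_num
      _ ≤ 2 ^ m i * (10 ^ m i * (1 / 2 : ℝ) ^ n i) := by gcongr; norm_num
      _ = 20 ^ m i * (1 / 2 : ℝ) ^ n i := by rw [← mul_assoc, ← mul_pow]; norm_num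

theorem abs_laguerreFun_le {d : ℕ} (n : Fin d → ℕ) (x : orthant d) :
    |laguerreFun n x.1| ≤ (∏ i, 5 ^ n i) * ∏ i, Real.exp (-(x.1 i / 4)) := by
  rw [laguerreFun, Finset.abs_prod, ← Finset.prod_mul_distrib]
  exact Finset.prod_le_prod (fun _ _ => abs_nonneg _) fun i _ => abs_laguerreFun1_le _ (x.2 i)

theorem abs_laguerreFun_le_pow {d : ℕ} (n : Fin d → ℕ) (x : orthant d) :
    |laguerreFun n x.1| ≤ ∏ i, 5 ^ n i := by
  refine (abs_laguerreFun_le n x).trans (mul_le_of_le_one_right (by positivity) ?_)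
  refine Finset.prod_le_one (fun _ _ => by positivity) fun i _ => ?_
  have := x.2 i
  rw [Real.exp_le_one_iff]
  linarith

/-- The Laguerre coefficients of `f ∘ w` in terms of the Hermite coefficients of `f`. -/
def laguerreTransform {d : ℕ} (a : (Fin d → ℕ) → ℂ) (n : Fin d → ℕ) : ℂ :=
  ∑' m, a (2 • m) * (laguerreOfHermite m n : ℂ)

theorem add_right_mem_range {d : ℕ} {m n : Fin d → ℕ} (h : ∀ i, n i ≤ m i) :
    m ∈ Set.range fun k => k + n :=
  ⟨fun i => m i - n i, funext fun i => Nat.sub_add_cancel (h i)⟩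

theorem hasSum_of_hasSum_of_summable_prod {α β : Type*} {T : α × β → ℂ} (hs : Summable T)
    {f : α → ℂ} {g : β → ℂ} {z : ℂ} (hf : ∀ m, HasSum (fun n => T (m, n)) (f m))
    (hg : ∀ n, HasSum (fun m => T (m, n)) (g n)) (hz : HasSum f z) : HasSum g z := by
  have h1 := hs.hasSum.prod_fiberwise hf
  have h2 : HasSum (fun p : β × α => T p.swap) (∑' p, T p) :=
    (Equiv.prodComm β α).hasSum_iff.mpr hs.hasSum
  rw [hz.unique h1]
  exact h2.prod_fiberwise hg

section Transform

variable {d : ℕ} {σ K R : ℝ} {a : (Fin d → ℕ) → ℂ}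

/-- The weight `5^n` is the uniform bound of `l_n` on the orthant, so this dominates the double
series at every point. -/
theorem summable_prod_norm_mul_pow (hσ : 0 < σ) (hR : 0 < R)
    (ha : ∀ m, ‖a (2 • m)‖ ≤ K * ∏ i, flatDecay R (1 / σ) (m i)) :
    Summable fun p : (Fin d → ℕ) × (Fin d → ℕ) =>
      ‖a (2 • p.1)‖ * |laguerreOfHermite p.1 p.2| * ∏ i, 5 ^ p.2 i := by
  have h1 : Summable fun m : Fin d → ℕ => K * ∏ i, flatDecay (20 * R) (1 / σ) (m i) :=
    (summable_prod_apply (flatDecay_nonneg (by positivity) _)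
      (summable_flatDecay (by positivity) (by positivity))).mul_left K
  have h2 : Summable fun n : Fin d → ℕ => ∏ i, (1 / 2 : ℝ) ^ n i :=
    summable_prod_apply (fun _ => by positivity) summable_geometric_two
  have hK : ∀ m : Fin d → ℕ, 0 ≤ K * ∏ i, flatDecay R (1 / σ) (m i) := fun m =>
    (norm_nonneg _).trans (ha m)
  have h3 : ∀ m : Fin d → ℕ, K * ∏ i, flatDecay (20 * R) (1 / σ) (m i) =
      (K * ∏ i, flatDecay R (1 / σ) (m i)) * ∏ i, 20 ^ m i := by
    intro m
    simp_rw [← mul_flatDecay, Finset.prod_mul_distrib]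
    ring
  refine Summable.of_nonneg_of_le (fun p => by positivity) (fun p => ?_)
    (h1.mul_of_nonneg h2 (fun m => ?_) fun n => ?_)
  · rw [h3, mul_assoc, mul_assoc]
    exact mul_le_mul (ha _) (abs_laguerreOfHermite_mul_le _ _) (by positivity) (hK _)
  · simp only [Pi.zero_apply]
    rw [h3]
    exact mul_nonneg (hK m) (by positivity)
  · simp only [Pi.zero_apply]
    positivity

theorem hasSum_laguerreTransform (hσ : 0 < σ) (hR : 0 < R)
    (ha : ∀ m, ‖a (2 • m)‖ ≤ K * ∏ i, flatDecay R (1 / σ) (m i)) (n : Fin d → ℕ) :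
    HasSum (fun m => a (2 • m) * (laguerreOfHermite m n : ℂ)) (laguerreTransform a n) := by
  have h : (1 : ℝ) ≤ ∏ i, 5 ^ n i := by
    rw [← Finset.prod_const_one (s := Finset.univ) (ι := Fin d)]
    exact Finset.prod_le_prod (fun _ _ => zero_le_one) fun i _ => one_le_pow₀ (by norm_num)
  refine Summable.hasSum (Summable.of_norm_bounded
    ((summable_prod_norm_mul_pow hσ hR ha).comp_injective (Prod.mk_left_injective n)) fun m => ?_)
  rw [norm_mul, Complex.norm_real, Real.norm_eq_abs]
  exact le_mul_of_one_le_right (by positivity) h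

theorem hasSum_laguerreTransform_add (hσ : 0 < σ) (hR : 0 < R)
    (ha : ∀ m, ‖a (2 • m)‖ ≤ K * ∏ i, flatDecay R (1 / σ) (m i)) (n : Fin d → ℕ) :
    HasSum (fun k => a (2 • (k + n)) * (laguerreOfHermite (k + n) n : ℂ))
      (laguerreTransform a n) := by
  refine ((add_left_injective n).hasSum_iff fun m hm => ?_).mpr
    (hasSum_laguerreTransform hσ hR ha n)
  have : ∃ i, m i < n i := by
    by_contra! h
    exact hm (add_right_mem_range h)
  obtain ⟨i, hi⟩ := this
  rw [laguerreOfHermite, Finset.prod_eq_zero (Finset.mem_univ i) (laguerreOfHermite1_of_lt hi)]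
  simp

theorem norm_laguerreTransform_le (hσ : 0 < σ) (hR : 0 < R)
    (ha : ∀ m, ‖a (2 • m)‖ ≤ K * ∏ i, flatDecay R (1 / σ) (m i)) :
    ∃ K', ∀ n, ‖laguerreTransform a n‖ ≤ K' * ∏ i, flatDecay (2 * R) (1 / σ) (n i) := by
  have h1 : Summable fun k : Fin d → ℕ => K * ∏ i, flatDecay (2 * R) (1 / σ) (k i) :=
    (summable_prod_apply (flatDecay_nonneg (by positivity) _)
      (summable_flatDecay (by positivity) (by positivity))).mul_left K
  have hK : 0 ≤ K := by
    have h0 := (norm_nonneg _).trans (ha 0)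
    exact nonneg_of_mul_nonneg_left h0 (Finset.prod_pos fun i _ => flatDecay_pos hR _ _)
  -- The bound `2^{k+n}` on the coefficients doubles `R`; submultiplicativity of `flatDecay` then
  -- separates `n` from the sum over `k`.
  refine ⟨∑' k : Fin d → ℕ, K * ∏ i, flatDecay (2 * R) (1 / σ) (k i), fun n => ?_⟩
  have h2 := hasSum_laguerreTransform_add hσ hR ha n
  rw [← h2.tsum_eq]
  refine tsum_of_norm_bounded (h1.hasSum.mul_right _) fun k => ?_
  rw [norm_mul, Complex.norm_real, Real.norm_eq_abs]
  calc ‖a (2 • (k + n))‖ * |laguerreOfHermite (k + n) n|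
      ≤ (K * ∏ i, flatDecay R (1 / σ) ((k + n) i)) * ∏ i, 2 ^ (k + n) i := by
        have h0 := (norm_nonneg _).trans (ha (k + n))
        gcongr
        · exact ha _
        · exact abs_laguerreOfHermite_le _ _
    _ = K * ∏ i, flatDecay (2 * R) (1 / σ) (k i + n i) := by
        simp_rw [← mul_flatDecay, Finset.prod_mul_distrib, Pi.add_apply]
        ring
    _ ≤ K * ∏ i, (flatDecay (2 * R) (1 / σ) (k i) * flatDecay (2 * R) (1 / σ) (n i)) := by
        gcongr with i
        · exact fun i _ => flatDecay_nonneg (by positivity) _ _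
        · exact flatDecay_add_le (by positivity) (by positivity) _ _
    _ = _ := by rw [Finset.prod_mul_distrib, mul_assoc]

theorem hasSum_laguerreTransform_mul_laguerreFun (hσ : 0 < σ) (hR : 0 < R)
    (ha : ∀ m, ‖a (2 • m)‖ ≤ K * ∏ i, flatDecay R (1 / σ) (m i)) {x : orthant d} {z : ℂ}
    (hz : HasSum (fun m => a (2 • m) * (hermiteFun (2 • m) (w x).1 : ℂ)) z) :
    HasSum (fun n => laguerreTransform a n * (laguerreFun n x.1 : ℂ)) z := by
  have hs : Summable fun p : (Fin d → ℕ) × (Fin d → ℕ) =>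
      a (2 • p.1) * (laguerreOfHermite p.1 p.2 : ℂ) * (laguerreFun p.2 x.1 : ℂ) := by
    refine Summable.of_norm_bounded (summable_prod_norm_mul_pow hσ hR ha) fun p => ?_
    rw [norm_mul, norm_mul, Complex.norm_real, Complex.norm_real, Real.norm_eq_abs,
      Real.norm_eq_abs]
    gcongr
    exact abs_laguerreFun_le_pow _ _
  refine hasSum_of_hasSum_of_summable_prod
    (f := fun m => a (2 • m) * (hermiteFun (2 • m) (w x).1 : ℂ))
    (g := fun n => laguerreTransform a n * (laguerreFun n x.1 : ℂ)) hs (fun m => ?_) (fun n => ?_) hz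
  · have := (Complex.hasSum_ofReal.mpr (hasSum_hermiteFun_two_smul_w m x)).mul_left (a (2 • m))
    simpa only [Complex.ofReal_mul, mul_assoc] using this
  · simpa only using (hasSum_laguerreTransform hσ hR ha n).mul_right (laguerreFun n x.1 : ℂ)

end Transform

/-! ### Parity: only even indices contribute. -/

theorem hermiteFun_update_neg {d : ℕ} (n : Fin d → ℕ) (x : Fin d → ℝ) (j : Fin d) :
    hermiteFun n (Function.update x j (-x j)) = (-1) ^ n j * hermiteFun n x := by
  rw [hermiteFun, hermiteFun, ← Finset.mul_prod_erase _ _ (Finset.mem_univ j),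
    ← Finset.mul_prod_erase Finset.univ _ (Finset.mem_univ j), Function.update_self,
    hermiteFun1_neg, mul_assoc]
  congr 2
  refine Finset.prod_congr rfl fun i hi => ?_
  rw [Function.update_of_ne (Finset.ne_of_mem_erase hi)]

/-- Averaging the expansions at `x` and at its reflection in coordinate `j` keeps `f x` and cancels
the terms odd in `x_j`. No uniqueness of Hermite coefficients is needed. -/
theorem hasSum_hermiteFun_of_even_on {d : ℕ} {f : (Fin d → ℝ) → ℂ} {a : (Fin d → ℕ) → ℂ}
    (hf : ∀ (x : Fin d → ℝ) (j : Fin d), f (Function.update x j (-x j)) = f x)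
    (hfa : HasHermiteExpansion f a) (s : Finset (Fin d)) (x : Fin d → ℝ) :
    HasSum (fun n => (if ∀ i ∈ s, Even (n i) then a n else 0) * (hermiteFun n x : ℂ)) (f x) := by
  induction s using Finset.induction_on generalizing x with
  | empty => simpa using hfa x
  | insert j s _ ih =>
    have h1 := ((ih x).add (ih (Function.update x j (-x j)))).div_const 2
    rw [hf, add_self_div_two] at h1
    convert! h1 using 2 with n
    rw [hermiteFun_update_neg]
    simp only [Finset.mem_insert, forall_eq_or_imp]
    rcases Nat.even_or_odd (n j) with h | h
    · simp only [h, true_and, h.neg_one_pow]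
      push_cast
      ring
    · simp [h.neg_one_pow, Nat.not_even_iff_odd.mpr h]

theorem hasSum_hermiteFun_two_smul {d : ℕ} {f : (Fin d → ℝ) → ℂ} {a : (Fin d → ℕ) → ℂ}
    (hf : ∀ (x : Fin d → ℝ) (j : Fin d), f (Function.update x j (-x j)) = f x)
    (hfa : HasHermiteExpansion f a) (x : Fin d → ℝ) :
    HasSum (fun n => a (2 • n) * (hermiteFun (2 • n) x : ℂ)) (f x) := by
  have h := hasSum_hermiteFun_of_even_on hf hfa Finset.univ x
  have hinj : Function.Injective fun n : Fin d → ℕ => 2 • n := by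
    intro m n hmn
    funext i
    have := congrFun hmn i
    simpa using this
  rw [← hinj.hasSum_iff] at h
  · refine h.congr_fun fun n => ?_
    simp
  · intro n hn
    rw [if_neg, zero_mul]
    intro h2
    refine hn ⟨fun i => n i / 2, funext fun i => ?_⟩
    simpa using Nat.two_mul_div_two_of_even (h2 i (Finset.mem_univ i))

/-! ### Integration over the orthant and recovery of the coefficients. -/

theorem orthant_eq_pi (d : ℕ) : orthant d = Set.univ.pi fun _ => Set.Ioi 0 := by
  ext x
  simp [orthant]

theorem measurableSet_orthant (d : ℕ) : MeasurableSet (orthant d) := by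
  rw [orthant_eq_pi]
  exact MeasurableSet.univ_pi fun _ => measurableSet_Ioi

theorem map_orthantMeasure (d : ℕ) : (orthantMeasure d).map Subtype.val =
    Measure.pi fun _ : Fin d => (volume : Measure ℝ).restrict (Set.Ioi 0) := by
  rw [orthantMeasure, map_comap_subtype_coe (measurableSet_orthant d), orthant_eq_pi, volume_pi,
    Measure.restrict_pi_pi]

theorem integrable_orthant_prod {d : ℕ} {u : Fin d → ℝ → ℝ}
    (hu : ∀ i, IntegrableOn (u i) (Set.Ioi 0)) :
    Integrable (fun x : orthant d => ∏ i, u i (x.1 i)) (orthantMeasure d) := by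
  refine ((MeasurableEmbedding.subtype_coe (measurableSet_orthant d)).integrable_map_iff
    (g := fun x => ∏ i, u i (x i))).mp ?_
  rw [map_orthantMeasure]
  exact Integrable.fintype_prod hu

theorem integral_orthant_prod {d : ℕ} (u : Fin d → ℝ → ℝ) :
    ∫ x : orthant d, ∏ i, u i (x.1 i) ∂orthantMeasure d = ∏ i, ∫ x in Set.Ioi 0, u i x := by
  rw [← (MeasurableEmbedding.subtype_coe (measurableSet_orthant d)).integral_map
    (fun x => ∏ i, u i (x i)), map_orthantMeasure, integral_fintype_prod_eq_prod]

theorem integral_laguerreFun_mul {d : ℕ} (m n : Fin d → ℕ) :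
    ∫ x : orthant d, laguerreFun m x.1 * laguerreFun n x.1 ∂orthantMeasure d =
      if m = n then 1 else 0 := by
  simp_rw [laguerreFun, ← Finset.prod_mul_distrib]
  rw [integral_orthant_prod fun i t => laguerreFun1 (m i) t * laguerreFun1 (n i) t]
  simp_rw [integral_laguerreFun1_mul, Finset.prod_ite_zero, Finset.prod_const_one, funext_iff]
  simp

theorem continuous_laguerreFun {d : ℕ} (n : Fin d → ℕ) : Continuous (laguerreFun n) :=
  continuous_finsetProd _ fun i _ => (continuous_laguerreFun1 (n i)).comp (continuous_apply i)

theorem abs_laguerreFun_mul_le {d : ℕ} (m n : Fin d → ℕ) (x : orthant d) :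
    |laguerreFun m x.1 * laguerreFun n x.1| ≤
      (∏ i, 5 ^ m i) * ((∏ i, 5 ^ n i) * ∏ i, Real.exp (-(1 / 2) * x.1 i)) := by
  rw [abs_mul]
  calc _ ≤ ((∏ i, 5 ^ m i) * ∏ i, Real.exp (-(x.1 i / 4))) *
        ((∏ i, 5 ^ n i) * ∏ i, Real.exp (-(x.1 i / 4))) := by
        gcongr <;> exact abs_laguerreFun_le _ _
    _ = (∏ i, 5 ^ m i) * ((∏ i, 5 ^ n i) *
        ∏ i, (Real.exp (-(x.1 i / 4)) * Real.exp (-(x.1 i / 4)))) := by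
        rw [Finset.prod_mul_distrib]; ring
    _ = _ := by
        simp_rw [← Real.exp_add]
        ring_nf

theorem integrable_exp_orthant (d : ℕ) :
    Integrable (fun x : orthant d => ∏ i, Real.exp (-(1 / 2) * x.1 i)) (orthantMeasure d) :=
  integrable_orthant_prod fun _ => integrableOn_exp_mul_Ioi (by norm_num) 0

section Expansion

variable {d : ℕ} {g : orthant d → ℂ} {b : (Fin d → ℕ) → ℂ}

theorem HasLaguerreExpansion.hasSum (hg : HasLaguerreExpansion g b) (x : orthant d) :
    HasSum (fun n => b n * (laguerreFun n x.1 : ℂ)) (g x) :=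
  hg x

theorem HasLaguerreExpansion.aestronglyMeasurable (hg : HasLaguerreExpansion g b) :
    AEStronglyMeasurable g (orthantMeasure d) := by
  refine aestronglyMeasurable_of_tendsto_ae (Filter.atTop : Filter (Finset (Fin d → ℕ)))
    (f := fun s x => ∑ n ∈ s, b n * (laguerreFun n x.1 : ℂ)) (fun s => ?_)
    (Filter.Eventually.of_forall fun x => ?_)
  · refine Continuous.aestronglyMeasurable (continuous_finsetSum _ fun n _ => ?_)
    exact continuous_const.mul (Complex.continuous_ofReal.comp
      ((continuous_laguerreFun n).comp continuous_subtype_val))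
  · have h := hg.hasSum x
    rwa [HasSum, SummationFilter.unconditional_filter] at h

theorem HasLaguerreExpansion.integrable_mul_laguerreFun (hg : HasLaguerreExpansion g b)
    (hb : Summable fun n => ‖b n‖ * ∏ i, 5 ^ n i) (n : Fin d → ℕ) :
    Integrable (fun x => g x * (laguerreFun n x.1 : ℂ)) (orthantMeasure d) := by
  refine (((integrable_exp_orthant d).const_mul (∏ i, 5 ^ n i)).const_mul
    (∑' k, ‖b k‖ * ∏ i, 5 ^ k i)).mono' (hg.aestronglyMeasurable.mul
    (Complex.continuous_ofReal.comp ((continuous_laguerreFun n).comp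
      continuous_subtype_val)).aestronglyMeasurable) (Filter.Eventually.of_forall fun x => ?_)
  have h := (hg.hasSum x).mul_right (laguerreFun n x.1 : ℂ)
  rw [← h.tsum_eq]
  refine tsum_of_norm_bounded (hb.hasSum.mul_right _) fun k => ?_
  rw [mul_assoc, norm_mul, ← Complex.ofReal_mul, Complex.norm_real, Real.norm_eq_abs, mul_assoc]
  gcongr
  exact abs_laguerreFun_mul_le k n x

/-- Termwise integration against `l_n` is dominated through `5^k` and the product of two factors
`e^{-x/4}`; orthonormality leaves only `k = n`. -/
theorem HasLaguerreExpansion.laguerreCoeff_eq (hg : HasLaguerreExpansion g b)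
    (hb : Summable fun n => ‖b n‖ * ∏ i, 5 ^ n i) : laguerreCoeff g = b := by
  funext n
  have h := hasSum_integral_of_dominated_convergence (μ := orthantMeasure d)
    (F := fun k x => b k * (laguerreFun k x.1 : ℂ) * (laguerreFun n x.1 : ℂ))
    (f := fun x => g x * (laguerreFun n x.1 : ℂ))
    (fun k x => (‖b k‖ * ∏ i, 5 ^ k i) *
      ((∏ i, 5 ^ n i) * ∏ i, Real.exp (-(1 / 2) * x.1 i)))
    (fun k => ?_) (fun k => Filter.Eventually.of_forall fun x => ?_)
    (Filter.Eventually.of_forall fun x =>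
      hb.mul_right ((∏ i, 5 ^ n i) * ∏ i, Real.exp (-(1 / 2) * x.1 i))) ?_
    (Filter.Eventually.of_forall fun x => (hg.hasSum x).mul_right _)
  · rw [laguerreCoeff, ← h.tsum_eq]
    have h2 : ∀ k, ∫ x : orthant d, b k * (laguerreFun k x.1 : ℂ) * (laguerreFun n x.1 : ℂ)
        ∂orthantMeasure d = if k = n then b k else 0 := by
      intro k
      simp_rw [mul_assoc, ← Complex.ofReal_mul]
      rw [integral_const_mul, integral_complex_ofReal, integral_laguerreFun_mul]
      split_ifs <;> simp
    simp_rw [h2]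
    rw [tsum_ite_eq]
  · have hc : ∀ m : Fin d → ℕ, Continuous fun x : orthant d => (laguerreFun m x.1 : ℂ) := fun m =>
      Complex.continuous_ofReal.comp ((continuous_laguerreFun m).comp continuous_subtype_val)
    exact ((continuous_const.mul (hc k)).mul (hc n)).aestronglyMeasurable
  · rw [mul_assoc, norm_mul, ← Complex.ofReal_mul, Complex.norm_real, Real.norm_eq_abs, mul_assoc]
    gcongr
    exact abs_laguerreFun_mul_le k n x
  · simp_rw [tsum_mul_right]
    exact ((integrable_exp_orthant d).const_mul _).const_mul _

end Expansion

/-! ### The closed formula and the main theorem. -/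

theorem laguerreOfHermite_add {d : ℕ} (k n : Fin d → ℕ) :
    laguerreOfHermite (k + n) n = ((-1) ^ multiLength n * 2 ^ multiLength n / Real.pi ^ ((d : ℝ) / 4)) *
      ((multiBinom (fun i => (k i : ℝ) - 3 / 2) k *
        ((-1) ^ multiLength k * 2 ^ multiLength k * (multiFactorial (k + n) : ℝ))) /
          √(multiFactorial (2 • (k + n)) : ℝ)) := by
  have hpi : Real.pi ^ ((d : ℝ) / 4) = ∏ _i : Fin d, Real.pi ^ ((1 : ℝ) / 4) := by
    rw [Finset.prod_const, Finset.card_univ, Fintype.card_fin, ← Real.rpow_natCast,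
      ← Real.rpow_mul Real.pi_pos.le]
    congr 1
    ring
  have hsqrt : √(multiFactorial (2 • (k + n)) : ℝ) = ∏ i, √((2 * (k i + n i))! : ℝ) := by
    rw [multiFactorial, Nat.cast_prod, Real.sqrt_prod _ fun i _ => by positivity]
    rfl
  rw [hpi, hsqrt, laguerreOfHermite, multiLength, multiLength, multiBinom, multiFactorial,
    Nat.cast_prod]
  simp_rw [← Finset.prod_pow_eq_pow_sum, ← Finset.prod_mul_distrib, ← Finset.prod_div_distrib,
    ← Finset.prod_mul_distrib]
  refine Finset.prod_congr rfl fun i _ => ?_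
  simp only [Pi.add_apply]
  rw [laguerreOfHermite1, if_pos (Nat.le_add_left _ _), Nat.add_sub_cancel, pow_add, pow_add]
  ring

end FlatPilipovic

end

theorem mainTheorem11 (d : ℕ) (σ : ℝ) (hσ : 0 < σ) (f : (Fin d → ℝ) → ℂ)
    (hf : f ∈ FlatPilipovic.hermiteFlatEven d σ)
    (a : (Fin d → ℕ) → ℂ) (ha : a ∈ FlatPilipovic.flatSeq d σ)
    (hfa : FlatPilipovic.HasHermiteExpansion f a)
    (g : FlatPilipovic.orthant d → ℂ)
    (hg : g = (fun y : FlatPilipovic.orthant d => f y.1) ∘ FlatPilipovic.w)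
    (b : (Fin d → ℕ) → ℂ) (hb : b = FlatPilipovic.laguerreCoeff g) :
    (∀ x, HasSum (fun n : Fin d → ℕ => a (2 • n) * (FlatPilipovic.hermiteFun (2 • n) x : ℂ))
      (f x)) ∧
    g ∈ FlatPilipovic.laguerreFlat d σ ∧
    (∀ n : Fin d → ℕ, MeasureTheory.Integrable
      (fun x : FlatPilipovic.orthant d => g x * (FlatPilipovic.laguerreFun n x.1 : ℂ))
      (FlatPilipovic.orthantMeasure d)) ∧
    FlatPilipovic.HasLaguerreExpansion g b ∧
    b ∈ FlatPilipovic.flatSeq d σ ∧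
    ∀ n : Fin d → ℕ, HasSum
      (fun k : Fin d → ℕ =>
        (((-1) ^ FlatPilipovic.multiLength n * 2 ^ FlatPilipovic.multiLength n
            / Real.pi ^ ((d : ℝ) / 4) : ℝ) : ℂ) *
          (((FlatPilipovic.multiBinom (fun i => (k i : ℝ) - 3 / 2) k *
              ((-1) ^ FlatPilipovic.multiLength k * 2 ^ FlatPilipovic.multiLength k *
                (FlatPilipovic.multiFactorial (k + n) : ℝ)) /
              √(FlatPilipovic.multiFactorial (2 • (k + n)) : ℝ) : ℝ) : ℂ) *
            a (2 • (k + n))))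
      (b n) := by
  open FlatPilipovic in
  have hfe := hasSum_hermiteFun_two_smul hf.2 hfa
  obtain ⟨K, R, -, hR, hK⟩ := norm_two_smul_le_of_mem_flatSeq hσ ha
  have hexp : HasLaguerreExpansion g (laguerreTransform a) := fun x => by
    rw [hg]
    exact hasSum_laguerreTransform_mul_laguerreFun hσ hR hK (hfe (w x).1)
  obtain ⟨K', hK'⟩ := norm_laguerreTransform_le hσ hR hK
  have hsum : Summable fun n => ‖laguerreTransform a n‖ * ∏ i, 5 ^ n i := by
    refine Summable.of_nonneg_of_le (fun n => by positivity) (fun n => ?_)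
      -- The weight `5^n` is absorbed into the rate of `flatDecay`.
      ((summable_prod_apply (flatDecay_nonneg (R := 5 * (2 * R)) (by positivity) (1 / σ))
        (summable_flatDecay (by positivity) (by positivity))).mul_left K')
    simp_rw [← mul_flatDecay 5, Finset.prod_mul_distrib]
    rw [mul_comm (∏ i, (5 : ℝ) ^ n i), ← mul_assoc]
    gcongr
    exact hK' n
  have hbT : b = laguerreTransform a := hb.trans (hexp.laguerreCoeff_eq hsum)
  have hR2 : 0 < 2 * R := by positivity
  refine ⟨hfe, ⟨_, mem_flatSeq_of_norm_le hR2 ?_ hK', hexp⟩, hexp.integrable_mul_laguerreFun hsum,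
    hbT ▸ hexp, hbT ▸ mem_flatSeq_of_norm_le hR2 ?_ hK', fun n => ?_⟩
  -- For `τ = σ/2` the exponents agree exactly; for `τ = σ` there is room, as `1/(2σ) ≤ 1/σ`.
  · rw [mul_div_cancel₀ _ two_ne_zero]
  · gcongr
    linarith
  · rw [hbT]
    refine (hasSum_laguerreTransform_add hσ hR hK n).congr_fun fun k => ?_
    rw [laguerreOfHermite_add]
    push_cast
    ring
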